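/- Let $\mathbb K$ be $\mathbb R$ or $\mathbb Z$. For a function $g$ on $\mathbb K$ let $\mathrm{Var}(g)\in[0,\infty]$ be its total variation, let $\mathrm{BV}(\mathbb K)$ be the set of $g\colon\mathbb K\to\mathbb C$ with $\mathrm{Var}(g)<\infty$, and for $a,b\in\mathbb C$ let \[ \mathrm{BV}_a^b(\mathbb K)=\Big\{g\in\mathrm{BV}(\mathbb K):\lim_{x\to-\infty}g(x)=a,\ \lim_{x\to+\infty}g(x)=b\Big\}. \] Let $M$ be the centered Hardy--Littlewood maximal operator, that is, \[ Mg(x)=\sup_{r>0}\frac1{2r}\int_{x-r}^{x+r}|g|\quad(x\in\mathbb R,\ g\in \mathrm{BV}(\mathbb R)),\qquad MG(n)=\sup_{m\ge0}\frac1{2m+1}\sum_{y=n-m}^{n+m}|G(y)|\quad(n\in\mathbb Z,\ G\in \mathrm{BV}(\mathbb Z)), \] where $m$ ranges over the nonnegative integers. Let $C(\mathbb K)$ be the smallest $C\in(0,\infty]$ such that $\mathrm{Var}(Mg)\le C\,\mathrm{Var}(g)$ for all $g\in\mathrm{BV}(\mathbb K)$, where $\infty\cdot 0=0$. If $C(\mathbb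 K)<\infty$, let $c_a^b(\mathbb K)$ be the largest $c\in[0,\infty)$ such that $\mathrm{Var}(Mg)\le C(\mathbb K)\,\mathrm{Var}(g)-c$ for all $g\in\mathrm{BV}_a^b(\mathbb K)$; if $C(\mathbb K)=\infty$, put $c_a^b(\mathbb K)=0$. Then these smallest and largest values exist, $C(\mathbb Z)=C(\mathbb R)$, and $c_a^b(\mathbb Z)=c_a^b(\mathbb R)$ for all $a,b\in\mathbb C$. -/

import Mathlib

noncomputable section

namespace CenteredMaximal

open Filter Topology
open scoped ENNReal NNReal

/-- The centered Hardy–Littlewood maximal function on `ℝ`: the supremum over `r > 0` of the averages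
of `|g|` over `(x - r, x + r)`. For `g` of bounded variation, `|g|` is bounded and measurable, so
every average is finite and the real supremum is over a bounded set. -/
def maximalR (g : ℝ → ℂ) (x : ℝ) : ℝ :=
  ⨆ r : {r : ℝ // 0 < r}, (1 / (2 * (r : ℝ))) * ∫ y in (x - r)..(x + r), ‖g y‖

/-- The centered Hardy–Littlewood maximal function on `ℤ`: the supremum over `m ≥ 0` of the averages
of `|G|` over `{n - m, …, n + m}`. -/
def maximalZ (G : ℤ → ℂ) (n : ℤ) : ℝ :=
  ⨆ m : ℕ, (1 / (2 * (m : ℝ) + 1)) * ∑ y ∈ Finset.Icc (n - (m : ℤ)) (n + (m : ℤ)), ‖G y‖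

/-- The total variation, with values in `[0, ∞]`. -/
def Var {K E : Type*} [LinearOrder K] [PseudoEMetricSpace E] (g : K → E) : ℝ≥0∞ :=
  eVariationOn g Set.univ

/-- `BV(K)`: functions of finite total variation. -/
def BV (K : Type*) [LinearOrder K] : Set (K → ℂ) :=
  {g | Var g < ∞}

/-- `BV_a^b(K)`: functions of finite total variation with limit `a` at `-∞` and `b` at `+∞`. -/
def BVLim (K : Type*) [LinearOrder K] (a b : ℂ) : Set (K → ℂ) :=
  {g | g ∈ BV K ∧ Tendsto g atBot (𝓝 a) ∧ Tendsto g atTop (𝓝 b)}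

/-- The constants `C ∈ (0, ∞]` with `Var (M g) ≤ C * Var g` for all `g ∈ BV(K)`. -/
def multConstants {K : Type*} [LinearOrder K] (M : (K → ℂ) → K → ℝ) : Set ℝ≥0∞ :=
  {C | 0 < C ∧ ∀ g ∈ BV K, Var (M g) ≤ C * Var g}

/-- `C(K)`, the smallest constant in `multConstants M`. -/
def bestC {K : Type*} [LinearOrder K] (M : (K → ℂ) → K → ℝ) : ℝ≥0∞ :=
  sInf (multConstants M)

/-- The constants `c ∈ [0, ∞)` with `Var (M g) ≤ C(K) * Var g - c` for all `g ∈ BV_a^b(K)`. The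
inequality is written additively, because subtraction in `ℝ≥0∞` is truncated. -/
def addConstants {K : Type*} [LinearOrder K] (M : (K → ℂ) → K → ℝ) (a b : ℂ) : Set ℝ≥0 :=
  {c | ∀ g ∈ BVLim K a b, Var (M g) + (c : ℝ≥0∞) ≤ bestC M * Var g}

open Classical in
/-- `c_a^b(K)`, the largest constant in `addConstants M a b`, with the convention that it is `0` if
`C(K) = ∞`. -/
def bestGain {K : Type*} [LinearOrder K] (M : (K → ℂ) → K → ℝ) (a b : ℂ) : ℝ≥0 :=
  if bestC M = ∞ then 0 else sSup (addConstants M a b)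

end CenteredMaximal

end

noncomputable section

namespace CenteredMaximal

open Filter Topology Set
open scoped ENNReal NNReal

/-! ### Functions of bounded variation -/

theorem Var_comp_le {K K' E : Type*} [LinearOrder K] [LinearOrder K'] [PseudoEMetricSpace E]
    (g : K → E) {φ : K' → K} (hφ : Monotone φ) : Var (g ∘ φ) ≤ Var g :=
  eVariationOn.comp_le_of_monotoneOn g φ (hφ.monotoneOn _) (mapsTo_univ _ _)

theorem boundedVariationOn_norm {K : Type*} [LinearOrder K] {g : K → ℂ} (hg : g ∈ BV K) :
    BoundedVariationOn (fun x => ‖g x‖) univ :=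
  lipschitzWith_one_norm.comp_boundedVariationOn (LT.lt.ne hg : BoundedVariationOn g univ)

theorem exists_norm_le {K : Type*} [LinearOrder K] [Nonempty K] {g : K → ℂ} (hg : g ∈ BV K) :
    ∃ B : ℝ, 0 ≤ B ∧ ∀ x, ‖g x‖ ≤ B := by
  obtain ⟨x₀⟩ := ‹Nonempty K›
  refine ⟨‖g x₀‖ + (Var g).toReal, by positivity, fun x => ?_⟩
  have h : dist (g x) (g x₀) ≤ (Var g).toReal :=
    BoundedVariationOn.dist_le (LT.lt.ne hg : BoundedVariationOn g univ) (mem_univ _) (mem_univ _)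
  rw [dist_eq_norm] at h
  linarith [norm_le_norm_add_norm_sub' (g x) (g x₀)]

theorem intervalIntegrable_norm {g : ℝ → ℂ} (hg : g ∈ BV ℝ) (a b : ℝ) :
    IntervalIntegrable (fun x => ‖g x‖) MeasureTheory.volume a b := by
  obtain ⟨p, q, hp, hq, h⟩ :=
    (boundedVariationOn_norm hg).locallyBoundedVariationOn.exists_monotoneOn_sub_monotoneOn
  rw [h]
  exact ((monotoneOn_univ.1 hp).intervalIntegrable).sub (monotoneOn_univ.1 hq).intervalIntegrable

/-! ### Averages and the maximal functions -/

theorem sum_Icc_sub_add_succ {E : Type*} [AddCommMonoid E] (F : ℤ → E) (n : ℤ) (m : ℕ) :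
    ∑ y ∈ Finset.Icc (n - ((m + 1 : ℕ) : ℤ)) (n + ((m + 1 : ℕ) : ℤ)), F y =
      ∑ y ∈ Finset.Icc (n - (m : ℤ)) (n + (m : ℤ)), F y + (F (n - (m + 1)) + F (n + (m + 1))) := by
  have h : Finset.Icc (n - ((m + 1 : ℕ) : ℤ)) (n + ((m + 1 : ℕ) : ℤ)) =
      insert (n - (m + 1 : ℤ)) (insert (n + (m + 1 : ℤ)) (Finset.Icc (n - (m : ℤ)) (n + (m : ℤ)))) := by
    ext k
    simp only [Finset.mem_Icc, Finset.mem_insert]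
    push_cast
    omega
  rw [h, Finset.sum_insert, Finset.sum_insert]
  · rw [add_comm (Finset.sum _ _), add_assoc]
  · simp
  · simp only [Finset.mem_Icc, Finset.mem_insert]
    omega

theorem integral_norm_le {g : ℝ → ℂ} (hg : g ∈ BV ℝ) {B : ℝ} (hB : ∀ x, ‖g x‖ ≤ B) {a b : ℝ}
    (hab : a ≤ b) : ∫ y in a..b, ‖g y‖ ≤ B * (b - a) := by
  have h := intervalIntegral.integral_mono_on hab (intervalIntegrable_norm hg a b)
    (intervalIntegrable_const (c := B)) (fun x _ => hB x)
  rw [intervalIntegral.integral_const, smul_eq_mul] at h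
  linarith

theorem bddAbove_averageR {g : ℝ → ℂ} (hg : g ∈ BV ℝ) (x : ℝ) :
    BddAbove (range fun r : {r : ℝ // 0 < r} =>
      (1 / (2 * (r : ℝ))) * ∫ y in (x - r)..(x + r), ‖g y‖) := by
  obtain ⟨B, -, hB⟩ := exists_norm_le hg
  refine ⟨B, ?_⟩
  rintro _ ⟨⟨r, hr⟩, rfl⟩
  have h := integral_norm_le hg hB (show x - r ≤ x + r by linarith)
  simp only
  rw [one_div, inv_mul_le_iff₀ (by positivity)]
  linarith

theorem integral_le_maximalR {g : ℝ → ℂ} (hg : g ∈ BV ℝ) (x : ℝ) {r : ℝ} (hr : 0 < r) :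
    ∫ y in (x - r)..(x + r), ‖g y‖ ≤ 2 * r * maximalR g x := by
  have h := le_ciSup (bddAbove_averageR hg x) ⟨r, hr⟩
  simp only at h
  rwa [one_div, inv_mul_le_iff₀ (by positivity)] at h

theorem maximalR_le {g : ℝ → ℂ} {x c : ℝ}
    (h : ∀ r : ℝ, 0 < r → ∫ y in (x - r)..(x + r), ‖g y‖ ≤ 2 * r * c) : maximalR g x ≤ c := by
  have : Nonempty {r : ℝ // 0 < r} := ⟨⟨1, one_pos⟩⟩
  refine ciSup_le ?_
  rintro ⟨r, hr⟩
  simp only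
  rw [one_div, inv_mul_le_iff₀ (by positivity)]
  exact h r hr

theorem exists_lt_integral {g : ℝ → ℂ} {x c : ℝ} (hc : c < maximalR g x) :
    ∃ r : ℝ, 0 < r ∧ 2 * r * c < ∫ y in (x - r)..(x + r), ‖g y‖ := by
  by_contra! h
  exact hc.not_ge (maximalR_le h)

theorem maximalR_nonneg {g : ℝ → ℂ} (hg : g ∈ BV ℝ) (x : ℝ) : 0 ≤ maximalR g x := by
  have h := integral_le_maximalR hg x one_pos
  have h' : 0 ≤ ∫ y in (x - 1)..(x + 1), ‖g y‖ :=
    intervalIntegral.integral_nonneg (by linarith) fun _ _ => norm_nonneg _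
  linarith

theorem maximalR_le_of_norm_le {g : ℝ → ℂ} (hg : g ∈ BV ℝ) {B : ℝ} (hB : ∀ x, ‖g x‖ ≤ B) (x : ℝ) :
    maximalR g x ≤ B :=
  maximalR_le fun r hr => by
    have h := integral_norm_le hg hB (show x - r ≤ x + r by linarith)
    linarith

theorem bddAbove_averageZ {G : ℤ → ℂ} (hG : G ∈ BV ℤ) (n : ℤ) :
    BddAbove (range fun m : ℕ =>
      (1 / (2 * (m : ℝ) + 1)) * ∑ y ∈ Finset.Icc (n - (m : ℤ)) (n + (m : ℤ)), ‖G y‖) := by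
  obtain ⟨B, -, hB⟩ := exists_norm_le hG
  refine ⟨B, ?_⟩
  rintro _ ⟨m, rfl⟩
  have h := Finset.sum_le_card_nsmul (Finset.Icc (n - (m : ℤ)) (n + (m : ℤ))) (fun y => ‖G y‖) B
    fun y _ => hB y
  have hc : (Finset.Icc (n - (m : ℤ)) (n + (m : ℤ))).card = 2 * m + 1 := by
    rw [Int.card_Icc]
    omega
  rw [hc, nsmul_eq_mul] at h
  push_cast at h
  simp only
  rwa [one_div, inv_mul_le_iff₀ (by positivity)]

theorem sum_le_maximalZ {G : ℤ → ℂ} (hG : G ∈ BV ℤ) (n : ℤ) (m : ℕ) :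
    ∑ y ∈ Finset.Icc (n - (m : ℤ)) (n + (m : ℤ)), ‖G y‖ ≤ (2 * m + 1) * maximalZ G n := by
  have h := le_ciSup (bddAbove_averageZ hG n) m
  rwa [one_div, inv_mul_le_iff₀ (by positivity)] at h

theorem maximalZ_le {G : ℤ → ℂ} {n : ℤ} {c : ℝ}
    (h : ∀ m : ℕ, ∑ y ∈ Finset.Icc (n - (m : ℤ)) (n + (m : ℤ)), ‖G y‖ ≤ (2 * m + 1) * c) :
    maximalZ G n ≤ c := by
  refine ciSup_le fun m => ?_
  rw [one_div, inv_mul_le_iff₀ (by positivity)]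
  exact h m

/-! ### From `ℤ` to `ℝ`: step functions -/

/-- The function on `ℝ` that is equal to `G n` on `[n - 1/2, n + 1/2)`. -/
def stepExtension (G : ℤ → ℂ) (x : ℝ) : ℂ :=
  G ⌊x + 1 / 2⌋

theorem Var_stepExtension_le (G : ℤ → ℂ) : Var (stepExtension G) ≤ Var G :=
  Var_comp_le G (φ := fun x : ℝ => ⌊x + 1 / 2⌋) fun _ _ h => Int.floor_mono (by linarith)

theorem stepExtension_mem_BV {G : ℤ → ℂ} (hG : G ∈ BV ℤ) : stepExtension G ∈ BV ℝ :=
  (Var_stepExtension_le G).trans_lt hG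

theorem stepExtension_mem_BVLim {G : ℤ → ℂ} {a b : ℂ} (hG : G ∈ BVLim ℤ a b) :
    stepExtension G ∈ BVLim ℝ a b :=
  ⟨stepExtension_mem_BV hG.1,
    hG.2.1.comp (tendsto_floor_atBot.comp (tendsto_atBot_add_const_right _ _ tendsto_id)),
    hG.2.2.comp (tendsto_floor_atTop.comp (tendsto_atTop_add_const_right _ _ tendsto_id))⟩

theorem integral_stepExtension_of_mem_cell (G : ℤ → ℂ) (k : ℤ) {u v : ℝ} (hu : (k : ℝ) - 1 / 2 ≤ u)
    (huv : u ≤ v) (hv : v ≤ k + 1 / 2) : ∫ y in u..v, ‖stepExtension G y‖ = (v - u) * ‖G k‖ := by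
  have h : EqOn (fun y => ‖stepExtension G y‖) (fun _ => ‖G k‖) (Ioo u v) := by
    intro y hy
    have : ⌊y + 1 / 2⌋ = k := Int.floor_eq_iff.2 ⟨by linarith [hy.1], by linarith [hy.2]⟩
    simp only [stepExtension, this]
  rw [intervalIntegral.integral_congr_Ioo_of_le huv h, intervalIntegral.integral_const, smul_eq_mul]

theorem integral_stepExtension_add {G : ℤ → ℂ} (hG : G ∈ BV ℤ) (n : ℤ) (m : ℕ) {s : ℝ}
    (hs : 0 ≤ s) (hs' : s ≤ 1) :
    ∫ y in (n - (m + 1 / 2 + s) : ℝ)..(n + (m + 1 / 2 + s)), ‖stepExtension G y‖ =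
      (∫ y in (n - (m + 1 / 2) : ℝ)..(n + (m + 1 / 2)), ‖stepExtension G y‖) +
        s * (‖G (n - (m + 1))‖ + ‖G (n + (m + 1))‖) := by
  have hi := intervalIntegrable_norm (stepExtension_mem_BV hG)
  rw [← intervalIntegral.integral_add_adjacent_intervals
      (hi (n - (m + 1 / 2 + s)) (n - (m + 1 / 2))) (hi (n - (m + 1 / 2)) (n + (m + 1 / 2 + s))),
    ← intervalIntegral.integral_add_adjacent_intervals
      (hi (n - (m + 1 / 2)) (n + (m + 1 / 2))) (hi (n + (m + 1 / 2)) (n + (m + 1 / 2 + s))),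
    integral_stepExtension_of_mem_cell G (n - (m + 1)) (u := n - (m + 1 / 2 + s))
      (v := n - (m + 1 / 2)) (by push_cast; linarith) (by linarith)
      (by push_cast; linarith),
    integral_stepExtension_of_mem_cell G (n + (m + 1)) (u := n + (m + 1 / 2))
      (v := n + (m + 1 / 2 + s)) (by push_cast; linarith) (by linarith)
      (by push_cast; linarith)]
  ring

theorem integral_stepExtension {G : ℤ → ℂ} (hG : G ∈ BV ℤ) (n : ℤ) (m : ℕ) :
    ∫ y in (n - (m + 1 / 2) : ℝ)..(n + (m + 1 / 2)), ‖stepExtension G y‖ =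
      ∑ y ∈ Finset.Icc (n - (m : ℤ)) (n + (m : ℤ)), ‖G y‖ := by
  induction m with
  | zero =>
    rw [integral_stepExtension_of_mem_cell G n (by simp) (by norm_num; linarith) (by simp)]
    simp
    ring
  | succ m ih =>
    rw [sum_Icc_sub_add_succ, ← ih, ← one_mul (‖G (n - (m + 1))‖ + _),
      ← integral_stepExtension_add hG n m zero_le_one le_rfl]
    push_cast
    ring_nf

/-- As a function of the radius, the integral is affine between consecutive radii `m + 1/2`, where
it equals the discrete sums. Hence the mean over any radius is a convex combination of discrete
means. -/
theorem maximalR_stepExtension {G : ℤ → ℂ} (hG : G ∈ BV ℤ) (n : ℤ) :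
    maximalR (stepExtension G) n = maximalZ G n := by
  have h0 := sum_le_maximalZ hG n
  apply le_antisymm
  · refine maximalR_le fun r hr => ?_
    rcases le_total r (1 / 2) with hr' | hr'
    · rw [integral_stepExtension_of_mem_cell G n (by linarith) (by linarith) (by linarith)]
      have h := h0 0
      simp only [Nat.cast_zero, sub_zero, add_zero, Finset.Icc_self, Finset.sum_singleton, mul_zero,
        zero_add, one_mul] at h
      nlinarith
    · obtain ⟨m, hm⟩ : ∃ m : ℕ, m = ⌊r - 1 / 2⌋₊ := ⟨_, rfl⟩
      have h1 : (m : ℝ) ≤ r - 1 / 2 := hm ▸ Nat.floor_le (by linarith)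
      have h2 : r - 1 / 2 < m + 1 := hm ▸ Nat.lt_floor_add_one _
      obtain ⟨s, rfl⟩ : ∃ s, r = m + 1 / 2 + s := ⟨r - (m + 1 / 2), by ring⟩
      rw [integral_stepExtension_add hG n m (by linarith) (by linarith), integral_stepExtension hG]
      have hm0 := h0 m
      have hm1 := h0 (m + 1)
      rw [sum_Icc_sub_add_succ] at hm1
      push_cast at hm1
      have e1 := mul_le_mul_of_nonneg_left hm0 (show 0 ≤ 1 - s by linarith)
      have e2 := mul_le_mul_of_nonneg_left hm1 (show 0 ≤ s by linarith)
      linarith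
  · refine maximalZ_le fun m => ?_
    rw [← integral_stepExtension hG]
    have h := integral_le_maximalR (stepExtension_mem_BV hG) n (r := m + 1 / 2) (by positivity)
    linarith

theorem Var_maximalZ_le {G : ℤ → ℂ} (hG : G ∈ BV ℤ) :
    Var (maximalZ G) ≤ Var (maximalR (stepExtension G)) := by
  have h : maximalZ G = maximalR (stepExtension G) ∘ ((↑) : ℤ → ℝ) :=
    funext fun n => (maximalR_stepExtension hG n).symm
  rw [h]
  exact Var_comp_le _ Int.cast_mono

/-! ### From `ℝ` to `ℤ`: sampling -/

theorem exists_monotone_majorant {g : ℝ → ℂ} (hg : g ∈ BV ℝ) :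
    ∃ (p : ℝ → ℝ) (V : ℝ), 0 ≤ V ∧ Monotone p ∧
      (∀ x y, x ≤ y → |‖g y‖ - ‖g x‖| ≤ p y - p x) ∧ ∀ x y, p y - p x ≤ V := by
  have hf := boundedVariationOn_norm hg
  have hl := hf.locallyBoundedVariationOn
  refine ⟨variationOnFromTo (fun x => ‖g x‖) univ 0,
    (eVariationOn (fun x => ‖g x‖) univ).toReal, ENNReal.toReal_nonneg,
    monotoneOn_univ.1 (variationOnFromTo.monotoneOn hl (mem_univ _)),
    fun x y hxy => variationOnFromTo.abs_sub_le_sub_of_le hl (mem_univ _) (mem_univ _)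
      (mem_univ _) hxy, fun x y => ?_⟩
  rw [variationOnFromTo.sub_right hl (mem_univ _) (mem_univ _) (mem_univ _)]
  exact (le_abs_self _).trans (variationOnFromTo.abs_le_eVariationOn hf)

/-- The error of the midpoint rule on one interval. -/
theorem abs_midpoint_sub_integral_le {g : ℝ → ℂ} (hg : g ∈ BV ℝ) {p : ℝ → ℝ} (hp : Monotone p)
    (hgp : ∀ x y, x ≤ y → |‖g y‖ - ‖g x‖| ≤ p y - p x) (c : ℝ) {h : ℝ} (hh : 0 ≤ h) {u v : ℝ}
    (hu : u = c - h / 2) (hv : v = c + h / 2) :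
    |h * ‖g c‖ - ∫ y in u..v, ‖g y‖| ≤ h * (p v - p u) := by
  subst hu hv
  have e : h * ‖g c‖ - ∫ y in (c - h / 2)..(c + h / 2), ‖g y‖ =
      ∫ y in (c - h / 2)..(c + h / 2), (‖g c‖ - ‖g y‖) := by
    rw [intervalIntegral.integral_sub intervalIntegrable_const (intervalIntegrable_norm hg _ _),
      intervalIntegral.integral_const, smul_eq_mul]
    ring
  have hb : ∀ y ∈ uIoc (c - h / 2) (c + h / 2),
      ‖‖g c‖ - ‖g y‖‖ ≤ p (c + h / 2) - p (c - h / 2) := by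
    intro y hy
    rw [uIoc_of_le (by linarith)] at hy
    rw [Real.norm_eq_abs]
    rcases le_total y c with hyc | hyc
    · linarith [hgp y c hyc, hp hy.1.le, hp (show c ≤ c + h / 2 by linarith)]
    · rw [abs_sub_comm]
      linarith [hgp c y hyc, hp hy.2, hp (show c - h / 2 ≤ c by linarith)]
  have h1 := intervalIntegral.norm_integral_le_of_norm_le_const hb
  rw [e, ← Real.norm_eq_abs]
  rw [show c + h / 2 - (c - h / 2) = h by ring, abs_of_nonneg hh] at h1
  linarith

/-- The midpoint errors on the cells telescope, so the total is at most `h` times the variation,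
uniformly in `m`. -/
theorem abs_sum_sub_integral_le {g : ℝ → ℂ} (hg : g ∈ BV ℝ) {p : ℝ → ℝ} (hp : Monotone p)
    (hgp : ∀ x y, x ≤ y → |‖g y‖ - ‖g x‖| ≤ p y - p x) (t : ℝ) {h : ℝ} (hh : 0 ≤ h) (n : ℤ)
    (m : ℕ) :
    |h * ∑ k ∈ Finset.Icc (n - (m : ℤ)) (n + (m : ℤ)), ‖g (t + k * h)‖ -
      ∫ y in (t + n * h - (m + 1 / 2) * h)..(t + n * h + (m + 1 / 2) * h), ‖g y‖| ≤
      h * (p (t + n * h + (m + 1 / 2) * h) - p (t + n * h - (m + 1 / 2) * h)) := by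
  induction m with
  | zero =>
    simp only [Nat.cast_zero, sub_zero, add_zero, Finset.Icc_self, Finset.sum_singleton]
    exact abs_midpoint_sub_integral_le hg hp hgp _ hh (by ring) (by ring)
  | succ m ih =>
    have hi := intervalIntegrable_norm hg
    have h1 := abs_midpoint_sub_integral_le hg hp hgp (t + (n - (m + 1) : ℤ) * h) hh
      (u := t + n * h - (((m + 1 : ℕ) : ℝ) + 1 / 2) * h) (v := t + n * h - (m + 1 / 2) * h)
      (by push_cast; ring) (by push_cast; ring)
    have h2 := abs_midpoint_sub_integral_le hg hp hgp (t + (n + (m + 1) : ℤ) * h) hh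
      (u := t + n * h + (m + 1 / 2) * h) (v := t + n * h + (((m + 1 : ℕ) : ℝ) + 1 / 2) * h)
      (by push_cast; ring) (by push_cast; ring)
    rw [sum_Icc_sub_add_succ, ← intervalIntegral.integral_add_adjacent_intervals
        (hi (t + n * h - (((m + 1 : ℕ) : ℝ) + 1 / 2) * h) (t + n * h - (m + 1 / 2) * h)) (hi _ _),
      ← intervalIntegral.integral_add_adjacent_intervals
        (hi (t + n * h - (m + 1 / 2) * h) (t + n * h + (m + 1 / 2) * h)) (hi _ _)]
    rw [abs_le] at *
    constructor <;> linarith [ih.1, ih.2, h1.1, h1.2, h2.1, h2.2]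

/-! ### One-sided limits and symmetric pairs near a point. -/

theorem add_oneSided_limits_le {g : ℝ → ℂ} (hg : g ∈ BV ℝ) {x L R : ℝ}
    (hL : Tendsto (fun y => ‖g y‖) (𝓝[<] x) (𝓝 L))
    (hR : Tendsto (fun y => ‖g y‖) (𝓝[>] x) (𝓝 R)) : L + R ≤ 2 * maximalR g x := by
  refine le_of_forall_pos_le_add fun ε hε => ?_
  obtain ⟨l, hl, hl'⟩ := (mem_nhdsLT_iff_exists_Ioo_subset' (sub_one_lt x)).1
    (hL.eventually (lt_mem_nhds (show L - ε / 2 < L by linarith)))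
  obtain ⟨u, hu, hu'⟩ := (mem_nhdsGT_iff_exists_Ioo_subset' (lt_add_one x)).1
    (hR.eventually (lt_mem_nhds (show R - ε / 2 < R by linarith)))
  simp only [mem_Iio, mem_Ioi] at hl hu
  obtain ⟨r, hr, hrl, hru⟩ : ∃ r : ℝ, 0 < r ∧ r ≤ x - l ∧ r ≤ u - x :=
    ⟨min (x - l) (u - x), lt_min (by linarith) (by linarith), min_le_left _ _, min_le_right _ _⟩
  have hi := intervalIntegrable_norm hg
  have h1 := intervalIntegral.integral_mono_on_of_le_Ioo (show x - r ≤ x by linarith)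
    (intervalIntegrable_const (c := L - ε / 2)) (hi (x - r) x)
    (fun y hy => (show _ < _ from hl' ⟨by linarith [hy.1], hy.2⟩).le)
  have h2 := intervalIntegral.integral_mono_on_of_le_Ioo (show x ≤ x + r by linarith)
    (intervalIntegrable_const (c := R - ε / 2)) (hi x (x + r))
    (fun y hy => (show _ < _ from hu' ⟨hy.1, by linarith [hy.2]⟩).le)
  have h3 := integral_le_maximalR hg x hr
  rw [← intervalIntegral.integral_add_adjacent_intervals (hi (x - r) x) (hi x (x + r))] at h3
  rw [intervalIntegral.integral_const, smul_eq_mul] at h1 h2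
  have h4 : r * (L + R) ≤ r * (2 * maximalR g x + ε) := by linarith
  exact le_of_mul_le_mul_left h4 hr

/-- On one side of `x`, the symmetric means of `‖g‖` about points close to `x` are at most
`maximalR g x`, up to a small error. The side is the one where the limit of `‖g‖` is smaller. -/
theorem exists_side_add_le {g : ℝ → ℂ} (hg : g ∈ BV ℝ) (x : ℝ) :
    ∃ σ : ℝ, (σ = 1 ∨ σ = -1) ∧ ∀ ε > 0, ∃ η > 0, ∀ y u : ℝ, 0 < σ * (y - x) → |y - x| < η →
      |u| < η → y - u ≠ x → y + u ≠ x → ‖g (y - u)‖ + ‖g (y + u)‖ ≤ 2 * maximalR g x + ε := by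
  have hf := boundedVariationOn_norm hg
  have hL := hf.tendsto_leftLim x
  have hR := hf.tendsto_rightLim x
  set L := Function.leftLim (fun y => ‖g y‖) x
  set R := Function.rightLim (fun y => ‖g y‖) x
  have hLR := add_oneSided_limits_le hg hL hR
  have key : ∀ ε > 0, ∃ η > 0, (∀ y, y < x → x - η < y → ‖g y‖ < L + ε) ∧
      ∀ y, x < y → y < x + η → ‖g y‖ < R + ε := by
    intro ε hε
    obtain ⟨l, hl, hl'⟩ := (mem_nhdsLT_iff_exists_Ioo_subset' (sub_one_lt x)).1
      (hL.eventually (gt_mem_nhds (show L < L + ε by linarith)))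
    obtain ⟨u, hu, hu'⟩ := (mem_nhdsGT_iff_exists_Ioo_subset' (lt_add_one x)).1
      (hR.eventually (gt_mem_nhds (show R < R + ε by linarith)))
    simp only [mem_Iio, mem_Ioi] at hl hu
    refine ⟨min (x - l) (u - x), lt_min (by linarith) (by linarith),
      fun y hy hy' => hl' ⟨?_, hy⟩, fun y hy hy' => hu' ⟨hy, ?_⟩⟩
    · linarith [min_le_left (x - l) (u - x)]
    · linarith [min_le_right (x - l) (u - x)]
  rcases le_total L R with hle | hle
  · refine ⟨-1, Or.inr rfl, fun ε hε => ?_⟩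
    obtain ⟨η, hη, hl, hr⟩ := key (ε / 2) (by linarith)
    refine ⟨η / 2, by linarith, fun y u hy hyη huη h1 h2 => ?_⟩
    rw [abs_lt] at hyη huη
    have hany : ∀ z, z ≠ x → x - η < z → z < x + η → ‖g z‖ < R + ε / 2 := fun z hz hz1 hz2 => by
      rcases lt_or_gt_of_ne hz with hz | hz
      · linarith [hl z hz hz1]
      · exact hr z hz hz2
    have a1 := hany _ h1 (by linarith) (by linarith)
    have a2 := hany _ h2 (by linarith) (by linarith)
    -- Since `y < x`, one of `y - u`, `y + u` lies left of `x` and is controlled by the smaller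
    -- limit `L`; the other is controlled by `R`.
    rcases le_total 0 u with hu | hu
    · linarith [hl (y - u) (by linarith) (by linarith)]
    · linarith [hl (y + u) (by linarith) (by linarith)]
  · refine ⟨1, Or.inl rfl, fun ε hε => ?_⟩
    obtain ⟨η, hη, hl, hr⟩ := key (ε / 2) (by linarith)
    refine ⟨η / 2, by linarith, fun y u hy hyη huη h1 h2 => ?_⟩
    rw [abs_lt] at hyη huη
    have hany : ∀ z, z ≠ x → x - η < z → z < x + η → ‖g z‖ < L + ε / 2 := fun z hz hz1 hz2 => by
      rcases lt_or_gt_of_ne hz with hz | hz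
      · exact hl z hz hz1
      · linarith [hr z hz hz2]
    have a1 := hany _ h1 (by linarith) (by linarith)
    have a2 := hany _ h2 (by linarith) (by linarith)
    rcases le_total 0 u with hu | hu
    · linarith [hr (y + u) (by linarith) (by linarith)]
    · linarith [hr (y - u) (by linarith) (by linarith)]

/-- The values of `g` on the lattice `t + h ℤ`. -/
def sample (g : ℝ → ℂ) (t h : ℝ) (k : ℤ) : ℂ :=
  g (t + k * h)

theorem Var_sample_le (g : ℝ → ℂ) (t : ℝ) {h : ℝ} (hh : 0 ≤ h) : Var (sample g t h) ≤ Var g :=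
  Var_comp_le g (φ := fun k : ℤ => t + k * h) fun _ _ hab => by
    have := mul_le_mul_of_nonneg_right (Int.cast_le (R := ℝ).2 hab) hh
    simp only
    linarith

theorem sample_mem_BV {g : ℝ → ℂ} (hg : g ∈ BV ℝ) (t : ℝ) {h : ℝ} (hh : 0 ≤ h) :
    sample g t h ∈ BV ℤ :=
  (Var_sample_le g t hh).trans_lt hg

theorem sample_mem_BVLim {g : ℝ → ℂ} {a b : ℂ} (hg : g ∈ BVLim ℝ a b) (t : ℝ) {h : ℝ}
    (hh : 0 < h) : sample g t h ∈ BVLim ℤ a b :=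
  ⟨sample_mem_BV hg.1 t hh.le,
    hg.2.1.comp (tendsto_atBot_add_const_left _ _
      ((tendsto_intCast_atBot_iff.2 tendsto_id).atBot_mul_const hh)),
    hg.2.2.comp (tendsto_atTop_add_const_left _ _
      (tendsto_intCast_atTop_atTop.atTop_mul_const hh))⟩

/-! ### Comparison of `maximalR g` with the maximal functions of samples. -/

theorem sum_Icc_le_of_pairs_le {F : ℤ → ℝ} {n : ℤ} {c : ℝ} {m : ℕ}
    (h : ∀ j : ℕ, j ≤ m → F (n - j) + F (n + j) ≤ 2 * c) :
    ∑ y ∈ Finset.Icc (n - (m : ℤ)) (n + (m : ℤ)), F y ≤ (2 * m + 1) * c := by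
  induction m with
  | zero =>
    have := h 0 le_rfl
    simp at this ⊢
    linarith
  | succ m ih =>
    have h1 := ih fun j hj => h j (by omega)
    have h2 := h (m + 1) le_rfl
    rw [sum_Icc_sub_add_succ]
    push_cast at h2 ⊢
    linarith

theorem maximalR_sub_le_maximalZ_sample {g : ℝ → ℂ} (hg : g ∈ BV ℝ) (x : ℝ) {ε : ℝ} (hε : 0 < ε) :
    ∃ h₀ > 0, ∀ (t h : ℝ) (n : ℤ), 0 < h → h < h₀ → |t + n * h - x| ≤ h →
      maximalR g x - ε ≤ maximalZ (sample g t h) n := by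
  obtain ⟨p, V, hV, hp, hgp, hpV⟩ := exists_monotone_majorant hg
  obtain ⟨B, hB, hgB⟩ := exists_norm_le hg
  obtain ⟨r, hr, hint⟩ := exists_lt_integral (show maximalR g x - ε / 2 < maximalR g x by linarith)
  have hMB := maximalR_le_of_norm_le hg hgB x
  refine ⟨r * ε / (6 * B + V + 1), by positivity, fun t h n hh hh₀ hx => ?_⟩
  rw [lt_div_iff₀ (by positivity)] at hh₀
  rw [abs_le] at hx
  -- The extra `1` absorbs the offset `|t + n * h - x| ≤ h`, so the discrete window contains `(x -
  -- r, x + r)`; its length `S` exceeds `2 * r` by at most `6 * h`.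
  obtain ⟨m, hm⟩ : ∃ m : ℕ, m = ⌈r / h⌉₊ + 1 := ⟨_, rfl⟩
  have hm1 : r ≤ (m - 1) * h := by
    rw [← div_le_iff₀ hh, hm]
    push_cast
    linarith [Nat.le_ceil (r / h)]
  have hm2 : (m : ℝ) * h < r + 2 * h := by
    have h1 : (m : ℝ) < r / h + 2 := by
      rw [hm]
      push_cast
      linarith [Nat.ceil_lt_add_one (show 0 ≤ r / h by positivity)]
    calc (m : ℝ) * h < (r / h + 2) * h := by gcongr
      _ = r + 2 * h := by field_simp
  have h1 := abs_le.1 (abs_sum_sub_integral_le hg hp hgp t hh.le n m)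
  have h2 : ∫ y in (x - r)..(x + r), ‖g y‖ ≤
      ∫ y in (t + n * h - (m + 1 / 2) * h)..(t + n * h + (m + 1 / 2) * h), ‖g y‖ :=
    intervalIntegral.integral_mono_interval (by linarith) (by linarith) (by linarith)
      (Eventually.of_forall fun _ => norm_nonneg _) (intervalIntegrable_norm hg _ _)
  have h3 : h * ∑ k ∈ Finset.Icc (n - (m : ℤ)) (n + (m : ℤ)), ‖g (t + k * h)‖ ≤
      h * ((2 * m + 1) * maximalZ (sample g t h) n) :=
    mul_le_mul_of_nonneg_left (sum_le_maximalZ (sample_mem_BV hg t hh.le) n m) hh.le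
  have h4 := mul_le_mul_of_nonneg_left
    (hpV (t + n * h - (m + 1 / 2) * h) (t + n * h + (m + 1 / 2) * h)) hh.le
  set S := 2 * ((m + 1 / 2) * h) with hS
  have hSr : 0 ≤ S - 2 * r := by linarith
  have hSr' : S - 2 * r ≤ 6 * h := by linarith
  have h5 : (S - 2 * r) * (maximalR g x - ε) ≤ 6 * h * B :=
    (mul_le_mul_of_nonneg_left (show maximalR g x - ε ≤ B by linarith) hSr).trans
      (mul_le_mul_of_nonneg_right hSr' hB)
  have h6 : S * (maximalR g x - ε) ≤ S * maximalZ (sample g t h) n := by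
    have : h * ((2 * m + 1) * maximalZ (sample g t h) n) = S * maximalZ (sample g t h) n := by
      rw [hS]; ring
    linarith [h1.1]
  exact le_of_mul_le_mul_left h6 (by linarith)

theorem maximalZ_sample_le {g : ℝ → ℂ} (hg : g ∈ BV ℝ) {x ε η : ℝ} (hε : 0 < ε) (hη : 0 < η) :
    ∃ h₀ > 0, ∀ (t h : ℝ) (n : ℤ), 0 < h → h < h₀ → |t + n * h - x| ≤ h →
      (∀ j : ℕ, j * h < η → ‖g (t + n * h - j * h)‖ + ‖g (t + n * h + j * h)‖ ≤
        2 * (maximalR g x + ε)) →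
      maximalZ (sample g t h) n ≤ maximalR g x + ε := by
  obtain ⟨p, V, hV, hp, hgp, hpV⟩ := exists_monotone_majorant hg
  have hM := maximalR_nonneg hg x
  set M := maximalR g x with hMdef
  refine ⟨2 * η * ε / (2 * M + V + 1), by positivity, fun t h n hh hh₀ hx hpair => ?_⟩
  rw [lt_div_iff₀ (by positivity)] at hh₀
  rw [abs_le] at hx
  refine maximalZ_le fun m => ?_
  -- Short windows are bounded pair by pair. For long ones, recentring at `x` costs `2 * h * M` and
  -- the Riemann sum `h * V`, both absorbed by the choice of `h₀`.
  rcases lt_or_ge (m * h) η with hm | hm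
  · refine sum_Icc_le_of_pairs_le (F := fun k => ‖sample g t h k‖) fun j hj => ?_
    have hj' : (j : ℝ) * h < η :=
      (mul_le_mul_of_nonneg_right (Nat.cast_le.2 hj) hh.le).trans_lt hm
    have := hpair j hj'
    simp only [sample]
    push_cast
    rw [sub_mul, add_mul, ← add_assoc, ← add_sub_assoc]
    exact this
  · have h1 := abs_le.1 (abs_sum_sub_integral_le hg hp hgp t hh.le n m)
    have h4 := mul_le_mul_of_nonneg_left
      (hpV (t + n * h - (m + 1 / 2) * h) (t + n * h + (m + 1 / 2) * h)) hh.le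
    have h2 : ∫ y in (t + n * h - (m + 1 / 2) * h)..(t + n * h + (m + 1 / 2) * h), ‖g y‖ ≤
        ∫ y in (x - ((m + 1 / 2) * h + h))..(x + ((m + 1 / 2) * h + h)), ‖g y‖ :=
      intervalIntegral.integral_mono_interval (by linarith) (by nlinarith) (by linarith)
        (Eventually.of_forall fun _ => norm_nonneg _) (intervalIntegrable_norm hg _ _)
    have h3 := integral_le_maximalR hg x (r := (m + 1 / 2) * h + h) (by positivity)
    have h5 : η * ε ≤ (m + 1 / 2) * h * ε := by gcongr; linarith
    refine le_of_mul_le_mul_left (a := h) ?_ hh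
    simp only [sample]
    rw [← hMdef] at h3
    linarith [h1.2]

/-- Sampling on fine lattices that avoid `x` recovers `maximalR g x` at the lattice points next to
`x` on a suitable side. -/
theorem exists_side_abs_sub_le {g : ℝ → ℂ} (hg : g ∈ BV ℝ) (x : ℝ) :
    ∃ σ : ℝ, (σ = 1 ∨ σ = -1) ∧ ∀ ε > 0, ∃ h₀ > 0, ∀ (t h : ℝ) (n : ℤ), 0 < h → h < h₀ →
      (∀ k : ℤ, t + k * h ≠ x) → 0 < σ * (t + n * h - x) → |t + n * h - x| ≤ h →
      |maximalZ (sample g t h) n - maximalR g x| ≤ ε := by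
  obtain ⟨σ, hσ, H⟩ := exists_side_add_le hg x
  refine ⟨σ, hσ, fun ε hε => ?_⟩
  obtain ⟨η, hη, Hη⟩ := H (2 * ε) (by linarith)
  obtain ⟨h₁, hh₁, H₁⟩ := maximalR_sub_le_maximalZ_sample hg x hε
  obtain ⟨h₂, hh₂, H₂⟩ := maximalZ_sample_le hg (x := x) hε hη
  refine ⟨min η (min h₁ h₂), lt_min hη (lt_min hh₁ hh₂), fun t h n hh hlt hne hside hx => ?_⟩
  have hη' := hlt.trans_le (min_le_left _ _)
  have h1 := hlt.trans_le ((min_le_right _ _).trans (min_le_left _ _))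
  have h2 := hlt.trans_le ((min_le_right _ _).trans (min_le_right _ _))
  have a1 := H₁ t h n hh h1 hx
  have a2 := H₂ t h n hh h2 hx fun j hj => by
    have := Hη (t + n * h) (j * h) hside (hx.trans_lt hη')
      (by rwa [abs_of_nonneg (by positivity)])
      (fun e => hne (n - j) (by push_cast; linarith))
      (fun e => hne (n + j) (by push_cast; linarith))
    linarith
  rw [abs_le]
  constructor <;> linarith

/-- If the lattices `t + ℤ / (N + 1)` avoid `x`, then `maximalR g x` is the limit of the maximal
functions of the samples along lattice points that converge to `x`. -/
theorem exists_tendsto_maximalZ_sample {g : ℝ → ℂ} (hg : g ∈ BV ℝ) {x t : ℝ}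
    (hxt : Irrational (x - t)) :
    ∃ s : ℕ → ℤ, Tendsto (fun N : ℕ => t + s N * (1 / ((N : ℝ) + 1))) atTop (𝓝 x) ∧
      Tendsto (fun N : ℕ => maximalZ (sample g t (1 / ((N : ℝ) + 1))) (s N)) atTop
        (𝓝 (maximalR g x)) := by
  have hne : ∀ (N : ℕ) (k : ℤ), t + k * (1 / ((N : ℝ) + 1)) ≠ x := by
    intro N k e
    refine hxt ⟨k * (1 / ((N : ℚ) + 1)), ?_⟩
    -- The spacing `1 / (N + 1)` is rational, so a lattice point at `x` would make `x - t` rational.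
    push_cast
    linarith
  have h0 : Tendsto (fun N : ℕ => 1 / ((N : ℝ) + 1)) atTop (𝓝 0) :=
    tendsto_one_div_add_atTop_nhds_zero_nat
  obtain ⟨σ, hσ, H⟩ := exists_side_abs_sub_le hg x
  have hs : ∃ s : ℕ → ℤ, ∀ N : ℕ, 0 < σ * (t + s N * (1 / ((N : ℝ) + 1)) - x) ∧
      |t + s N * (1 / ((N : ℝ) + 1)) - x| ≤ 1 / ((N : ℝ) + 1) := by
    refine ⟨fun N => if σ = 1 then ⌊(x - t) * (N + 1)⌋ + 1 else ⌊(x - t) * (N + 1)⌋, fun N => ?_⟩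
    have hpos : (0 : ℝ) < 1 / ((N : ℝ) + 1) := by positivity
    have e : (x - t) * (N + 1) * (1 / ((N : ℝ) + 1)) = x - t := by field_simp
    have f1 := mul_le_mul_of_nonneg_right (Int.floor_le ((x - t) * (N + 1))) hpos.le
    have f2 := mul_lt_mul_of_pos_right (Int.lt_floor_add_one ((x - t) * (N + 1))) hpos
    have f3 := hne N ⌊(x - t) * (N + 1)⌋
    have f4 : t + ⌊(x - t) * (N + 1)⌋ * (1 / ((N : ℝ) + 1)) < x :=
      lt_of_le_of_ne (by linarith) f3
    rw [e] at f1 f2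
    rw [abs_le]
    rcases hσ with rfl | rfl
    · simp only [if_true]
      push_cast
      refine ⟨?_, ?_, ?_⟩ <;> linarith
    · simp only [show (-1 : ℝ) ≠ 1 by norm_num, if_false]
      refine ⟨?_, ?_, ?_⟩ <;> linarith
  obtain ⟨s, hs⟩ := hs
  refine ⟨s, ?_, ?_⟩
  · exact tendsto_iff_dist_tendsto_zero.2 (squeeze_zero (fun _ => dist_nonneg)
      (fun N => (hs N).2) h0)
  · rw [Metric.tendsto_nhds]
    intro ε hε
    obtain ⟨h₀, hh₀, H'⟩ := H (ε / 2) (by linarith)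
    filter_upwards [h0.eventually (gt_mem_nhds hh₀)] with N hN
    have := H' t _ (s N) (by positivity) hN (hne N) (hs N).1 (hs N).2
    rw [Real.dist_eq]
    linarith

theorem exists_forall_irrational_sub (u : ℕ → ℝ) : ∃ t : ℝ, ∀ i, Irrational (u i - t) := by
  have hc : (⋃ i, range fun q : ℚ => u i - q).Countable :=
    countable_iUnion fun i => countable_range _
  obtain ⟨t, ht⟩ := (hc.dense_compl ℝ).nonempty
  refine ⟨t, fun i => ?_⟩
  rintro ⟨q, hq⟩
  exact ht (mem_iUnion.2 ⟨i, q, by simp only; linarith⟩)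

theorem Var_maximalR_le {g : ℝ → ℂ} (hg : g ∈ BV ℝ) {v : ℝ≥0∞}
    (h : ∀ t h : ℝ, 0 < h → Var (maximalZ (sample g t h)) ≤ v) : Var (maximalR g) ≤ v := by
  refine iSup_le ?_
  rintro ⟨n, u, hu, -⟩
  obtain ⟨t, ht⟩ := exists_forall_irrational_sub u
  have hex : ∀ x : range u, ∃ s : ℕ → ℤ,
      Tendsto (fun N : ℕ => t + s N * (1 / ((N : ℝ) + 1))) atTop (𝓝 (x : ℝ)) ∧
      Tendsto (fun N : ℕ => maximalZ (sample g t (1 / ((N : ℝ) + 1))) (s N)) atTop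
        (𝓝 (maximalR g x)) := by
    rintro ⟨_, i, rfl⟩
    exact exists_tendsto_maximalZ_sample hg (ht i)
  choose s hs hs' using hex
  -- The lattice approximations are attached to points, not indices: repeated values of `u` get the
  -- same sequence, which keeps the approximations monotone.
  set w : ℕ → range u := fun i => ⟨u i, mem_range_self i⟩
  have hlim : Tendsto (fun N : ℕ => ∑ i ∈ Finset.range n,
      edist (maximalZ (sample g t (1 / ((N : ℝ) + 1))) (s (w (i + 1)) N))
        (maximalZ (sample g t (1 / ((N : ℝ) + 1))) (s (w i) N))) atTop
      (𝓝 (∑ i ∈ Finset.range n, edist (maximalR g (u (i + 1))) (maximalR g (u i)))) :=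
    tendsto_finsetSum _ fun i _ => (hs' (w (i + 1))).edist (hs' (w i))
  have hmono : ∀ᶠ N : ℕ in atTop, ∀ i ∈ Finset.Iic n, ∀ j ∈ Finset.Iic n, i ≤ j →
      s (w i) N ≤ s (w j) N := by
    rw [Finset.eventually_all]
    intro i _
    rw [Finset.eventually_all]
    intro j _
    rcases lt_or_ge j i with hji | hij
    · exact Eventually.of_forall fun N h' => absurd h' hji.not_ge
    rcases (hu hij).eq_or_lt with heq | hlt
    · have : w i = w j := Subtype.ext heq
      exact Eventually.of_forall fun N _ => by rw [this]
    · filter_upwards [(hs (w i)).eventually_lt (hs (w j)) hlt] with N hN _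
      have hN' := lt_of_mul_lt_mul_right (lt_of_add_lt_add_left hN) (by positivity)
      exact (Int.cast_lt.1 hN').le
  refine le_of_tendsto hlim ?_
  filter_upwards [hmono] with N hN
  refine le_trans ?_ (h t (1 / ((N : ℝ) + 1)) (by positivity))
  exact eVariationOn.sum_le_of_monotoneOn_Iic (u := fun i => s (w i) N)
    (fun i hi j hj hij => hN i (Finset.mem_Iic.2 hi) j (Finset.mem_Iic.2 hj) hij)
    fun _ _ => mem_univ _

/-! ### Existence and equality of the extremal constants -/

/-- The function on `ℤ` that is `a` on the negative integers and `b` elsewhere. -/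
def jump (a b : ℂ) (n : ℤ) : ℂ :=
  if 0 ≤ n then b else a

/-- This makes `BVLim ℤ a b` nonempty, which bounds the additive constants; `jump 0 1` also forces
`bestC` to be positive. -/
theorem jump_mem_BVLim (a b : ℂ) : jump a b ∈ BVLim ℤ a b := by
  refine ⟨?_, ?_, ?_⟩
  · have hm : Monotone fun n : ℤ => if 0 ≤ n then (1 : ℝ) else 0 := by
      intro i j hij
      simp only
      split_ifs <;> first | omega | norm_num
    have hb : BoundedVariationOn (fun n : ℤ => if 0 ≤ n then (1 : ℝ) else 0) univ :=
      (hm.monotoneOn _).boundedVariationOn (C := 1) fun n _ => by split_ifs <;> norm_num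
    have hl : LipschitzWith ‖b - a‖₊ fun s : ℝ => a + s * (b - a) := by
      refine LipschitzWith.of_dist_le_mul fun s t => le_of_eq ?_
      rw [dist_eq_norm, dist_eq_norm, coe_nnnorm,
        show a + s * (b - a) - (a + t * (b - a)) = ((s - t : ℝ) : ℂ) * (b - a) by push_cast; ring,
        norm_mul, Complex.norm_real, mul_comm]
    have he : jump a b =
        (fun s : ℝ => a + s * (b - a)) ∘ fun n : ℤ => if 0 ≤ n then (1 : ℝ) else 0 := by
      funext n
      simp only [jump, Function.comp_apply]
      split_ifs <;> simp
    rw [he]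
    exact (hl.comp_boundedVariationOn hb).lt_top
  · refine tendsto_const_nhds.congr' ?_
    filter_upwards [eventually_lt_atBot (0 : ℤ)] with n hn
    rw [jump, if_neg (by omega)]
  · refine tendsto_const_nhds.congr' ?_
    filter_upwards [eventually_ge_atTop (0 : ℤ)] with n hn
    rw [jump, if_pos hn]

theorem Var_maximalZ_jump_ne_zero : Var (maximalZ (jump 0 1)) ≠ 0 := by
  intro h
  have hG := (jump_mem_BVLim 0 1).1
  have h1 : (1 : ℝ) ≤ maximalZ (jump 0 1) 0 := by
    simpa [jump] using sum_le_maximalZ hG 0 0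
  have h2 : maximalZ (jump 0 1) (-1) ≤ 1 / 2 := by
    refine maximalZ_le fun m => sum_Icc_le_of_pairs_le (F := fun y => ‖jump 0 1 y‖) fun j _ => ?_
    have hj : ¬ (0 : ℤ) ≤ -1 - j := by omega
    simp only [jump, if_neg hj]
    split_ifs <;> norm_num
  have h3 := (eVariationOn.eq_zero_iff _).1 h 0 (mem_univ _) (-1) (mem_univ _)
  rw [edist_eq_zero] at h3
  linarith

theorem multConstants_eq : multConstants maximalZ = multConstants maximalR := by
  ext C
  refine and_congr_right fun _ => ⟨fun H g hg => ?_, fun H G hG => ?_⟩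
  · exact Var_maximalR_le hg fun t h hh =>
      (H _ (sample_mem_BV hg t hh.le)).trans (by gcongr; exact Var_sample_le g t hh.le)
  · exact (Var_maximalZ_le hG).trans ((H _ (stepExtension_mem_BV hG)).trans
      (by gcongr; exact Var_stepExtension_le G))

theorem bestC_eq : bestC maximalZ = bestC maximalR := by
  rw [bestC, bestC, multConstants_eq]

theorem addConstants_eq (a b : ℂ) : addConstants maximalZ a b = addConstants maximalR a b := by
  ext c
  simp only [addConstants, mem_ofPred_eq, bestC_eq]
  refine ⟨fun H g hg => ?_, fun H G hG => ?_⟩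
  · have h : ∀ t h : ℝ, 0 < h →
        Var (maximalZ (sample g t h)) + c ≤ bestC maximalR * Var g := fun t h hh =>
      (H _ (sample_mem_BVLim hg t hh)).trans (by gcongr; exact Var_sample_le g t hh.le)
    -- Moving `c` to the right gives a bound of the form needed. Subtraction is truncated, so
    -- undoing it needs `c ≤ bestC maximalR * Var g`, which one lattice (`t = 0`, `h = 1`) supplies.
    have h' := Var_maximalR_le hg.1 fun t s hs => ENNReal.le_sub_of_add_le_right
      ENNReal.coe_ne_top (h t s hs)
    exact (add_le_add_left h' _).trans_eq
      (tsub_add_cancel_of_le (le_add_self.trans (h 0 1 one_pos)))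
  · refine le_trans ?_ ((H _ (stepExtension_mem_BVLim hG)).trans
      (by gcongr; exact Var_stepExtension_le G))
    gcongr
    exact Var_maximalZ_le hG.1

theorem Var_maximalZ_eq_zero {G : ℤ → ℂ} (h : Var G = 0) : Var (maximalZ G) = 0 := by
  have hc : ∀ n, G n = G 0 := fun n =>
    edist_eq_zero.1 ((eVariationOn.eq_zero_iff _).1 h n (mem_univ _) 0 (mem_univ _))
  refine eVariationOn.constant_on ?_
  rintro _ ⟨n, -, rfl⟩ _ ⟨k, -, rfl⟩
  have hcard : ∀ (n : ℤ) (m : ℕ), (Finset.Icc (n - (m : ℤ)) (n + (m : ℤ))).card = 2 * m + 1 :=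
    fun n m => by
      rw [Int.card_Icc]
      omega
  simp only [maximalZ, hc, Finset.sum_const, hcard]

theorem isLeast_multConstants : IsLeast (multConstants maximalZ) (bestC maximalZ) := by
  refine ⟨⟨?_, fun G hG => ?_⟩, fun C hC => sInf_le hC⟩
  · have hG := (jump_mem_BVLim 0 1).1
    have hV : Var (jump 0 1) ≠ ∞ := LT.lt.ne hG
    refine lt_of_lt_of_le (ENNReal.div_pos Var_maximalZ_jump_ne_zero hV) (le_sInf fun C hC => ?_)
    exact ENNReal.div_le_of_le_mul (hC.2 _ hG)
  -- When `Var G = 0` division is unavailable, but `G` is constant and so is its maximal function.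
  · rcases eq_or_ne (Var G) 0 with h0 | h0
    · rw [Var_maximalZ_eq_zero h0]
      exact zero_le
    · have hV : Var G ≠ ∞ := LT.lt.ne hG
      rw [← ENNReal.div_le_iff h0 hV]
      exact le_sInf fun C hC => ENNReal.div_le_of_le_mul (hC.2 _ hG)

theorem isGreatest_addConstants (a b : ℂ) (hC : bestC maximalZ ≠ ∞) :
    IsGreatest (addConstants maximalZ a b) (bestGain maximalZ a b) := by
  rw [bestGain, if_neg hC]
  have hfin : ∀ G ∈ BVLim ℤ a b, bestC maximalZ * Var G ≠ ∞ := fun G hG =>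
    ENNReal.mul_ne_top hC (LT.lt.ne hG.1)
  have hbdd : BddAbove (addConstants maximalZ a b) := by
    refine ⟨(bestC maximalZ * Var (jump a b)).toNNReal, fun c hc => ?_⟩
    exact ENNReal.le_toNNReal_of_coe_le (le_add_self.trans (hc _ (jump_mem_BVLim a b)))
      (hfin _ (jump_mem_BVLim a b))
  have hne : (addConstants maximalZ a b).Nonempty :=
    ⟨0, fun G hG => by simpa using isLeast_multConstants.1.2 G hG.1⟩
  have hclosed : IsClosed (addConstants maximalZ a b) := by
    simp only [addConstants, ofPred_forall]
    refine isClosed_iInter fun G => isClosed_iInter fun _ => isClosed_le ?_ continuous_const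
    exact continuous_const.add ENNReal.continuous_coe
  exact ⟨hclosed.csSup_mem hne hbdd, fun c hc => le_csSup hbdd hc⟩

theorem bestGain_eq (a b : ℂ) : bestGain maximalZ a b = bestGain maximalR a b := by
  rw [bestGain, bestGain, addConstants_eq, bestC_eq]

end CenteredMaximal

end

theorem theorem2 :
    (IsLeast (CenteredMaximal.multConstants CenteredMaximal.maximalZ)
        (CenteredMaximal.bestC CenteredMaximal.maximalZ) ∧
      IsLeast (CenteredMaximal.multConstants CenteredMaximal.maximalR)
        (CenteredMaximal.bestC CenteredMaximal.maximalR) ∧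
      CenteredMaximal.bestC CenteredMaximal.maximalZ =
        CenteredMaximal.bestC CenteredMaximal.maximalR) ∧
    ∀ a b : ℂ,
      (CenteredMaximal.bestC CenteredMaximal.maximalZ ≠ ⊤ →
        IsGreatest (CenteredMaximal.addConstants CenteredMaximal.maximalZ a b)
          (CenteredMaximal.bestGain CenteredMaximal.maximalZ a b)) ∧
      (CenteredMaximal.bestC CenteredMaximal.maximalR ≠ ⊤ →
        IsGreatest (CenteredMaximal.addConstants CenteredMaximal.maximalR a b)
          (CenteredMaximal.bestGain CenteredMaximal.maximalR a b)) ∧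
      CenteredMaximal.bestGain CenteredMaximal.maximalZ a b =
        CenteredMaximal.bestGain CenteredMaximal.maximalR a b := by
  have h := CenteredMaximal.isLeast_multConstants
  refine ⟨⟨h, ?_, CenteredMaximal.bestC_eq⟩, fun a b => ?_⟩
  · rwa [← CenteredMaximal.bestC_eq, ← CenteredMaximal.multConstants_eq]
  · refine ⟨CenteredMaximal.isGreatest_addConstants a b, fun hC => ?_,
      CenteredMaximal.bestGain_eq a b⟩
    rw [← CenteredMaximal.bestGain_eq, ← CenteredMaximal.addConstants_eq]
    exact CenteredMaximal.isGreatest_addConstants a b (CenteredMaximal.bestC_eq ▸ hC)
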